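/- **Setting.** A temporal network $T=(V,E)$ consists of a finite set $V$ of $n\ge 2$ nodes and a finite set $E$ of directed edges $(u,v,t)$ with $u,v\in V$, $u\ne v$ and timestamp $t>0$. A *temporal walk* from $s$ to $z$ is a nonempty sequence of edges $(u_1,v_1,t_1),\dots,(u_k,v_k,t_k)$ of $E$ with $u_1=s$, $v_k=z$, $v_i=u_{i+1}$ and $t_i<t_{i+1}$ for $1\le i<k$; its length is $k$. It is a *temporal path* if no node is visited more than once, and it is *$\delta$-restless* if $t_{i+1}\le t_i+\delta$ for $1\le i<k$. Fix one of two optimality criteria: under STP, the set $\mathcal P_{s,z}$ of optimal paths consists of the temporal paths from $s$ to $z$ of minimum length; under RTP with parameter $\delta$, it consists of the $\delta$-restless temporal walks from $s$ to $z$ of minimum length among all such walks. Let $\sigma_{s,z}=|\mathcal P_{s,z}|$ and let $\sigma_{s,z}(v)$ be the number of elements of $\mathcal P_{s,z}$ that visit $v$, where $v\neq s,z$ (and $\sigma_{s,z}(v)=0$ if $v\in\{s,z\}$). The temporal betweenness centrality of $v\in V$ is $$b(v)=\frac1{n(n-1)}\sum_{s,z\in V,\ s\ne z}\frac{\sigma_{s,z}(v)}{\sigma_{s,z}},$$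 where a term with $\sigma_{s,z}=0$ counts as $0$. **Algorithm ONBRA.** On input $T$, $\eta\in(0,1)$ and an integer $\ell\ge 2$, ONBRA starts from the zero matrix $\tilde B\in\mathbb R^{V\times\{1,\dots,\ell\}}$. In each iteration $i=1,\dots,\ell$ it draws, independently of the previous draws, a pair $(s,z)$ uniformly at random from $\{(u,v)\in V^2:u\ne v\}$ and, if $\mathcal P_{s,z}\neq\emptyset$, sets $\tilde B_{v,i}=\sigma_{s,z}(v)/\sigma_{s,z}$ for every node $v$ internal to some element of $\mathcal P_{s,z}$. It returns $(\varepsilon',\tilde B(T))$, where $\tilde B(T)=\{(v,\tilde b(v)):v\in V\}$, $\tilde b(v)=\frac1\ell\sum_{i=1}^\ell\tilde B_{v,i}$ and $$\varepsilon'=\sup_{v\in V}\left\{\sqrt{\frac{2\,\mathbf V(\tilde B_{v,:})\ln(4n/\eta)}{\ell}}+\frac{7\ln(4n/\eta)}{3(\ell-1)}\right\},\qquad \mathbf V(\tilde B_{v,:})=\frac1{\ell(\ell-1)}\sum_{1\le i<j\le\ell}(\tilde B_{v,i}-\tilde B_{v,j})^2 .$$ **Corollary.** For every temporal network $T$ with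 at least two nodes, every $\eta\in(0,1)$, every integer $\ell\ge2$, and under both the STP criterion and the RTP criterion (for every $\delta$), the pair $(\varepsilon',\tilde B(T))$ returned by ONBRA satisfies $$\mathbb P\left[\sup_{v\in V}|\tilde b(v)-b(v)|\le\varepsilon'\right]>1-\eta ,$$ that is, $\tilde B(T)$ is an absolute $(\varepsilon',\eta)$-approximation set of $B(T)=\{(v,b(v)):v\in V\}$. -/

import Mathlib

open scoped BigOperators

/-- A directed edge `(u, v, t)` from `u = src` to `v = dst` with timestamp `t = time`. -/
structure TemporalEdge (V : Type*) where
  src : V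
  dst : V
  time : ℝ

/-- A temporal network on the node set `V`: a finite set of directed edges without self-loops and
with positive timestamps. -/
structure TemporalNetwork (V : Type*) where
  edges : Finset (TemporalEdge V)
  src_ne_dst : ∀ e ∈ edges, e.src ≠ e.dst
  time_pos : ∀ e ∈ edges, 0 < e.time

/-- The optimality criteria: shortest temporal paths (`stp`), and shortest `δ`-restless temporal
walks (`rtp δ`). -/
inductive PathCriterion where
  | stp : PathCriterion
  | rtp (δ : ℝ) : PathCriterion

/-- The set `𝒟` of ordered pairs of distinct nodes. -/
abbrev NodePair (V : Type*) : Type _ := {p : V × V // p.1 ≠ p.2}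

instance NodePair.instNonempty {V : Type*} [Nontrivial V] : Nonempty (NodePair V) :=
  let ⟨u, v, h⟩ := exists_pair_ne V
  ⟨⟨(u, v), h⟩⟩

namespace TemporalNetwork

variable {V : Type*}

/-- A temporal walk: a nonempty sequence of edges of the network, consecutive edges sharing the
intermediate node, with strictly increasing timestamps. -/
def IsWalk (T : TemporalNetwork V) (p : List (TemporalEdge V)) : Prop :=
  p ≠ [] ∧ (∀ e ∈ p, e ∈ T.edges) ∧ p.IsChain (fun e f => e.dst = f.src ∧ e.time < f.time)

/-- The sequence `u₁, v₁, v₂, …, v_k` of the nodes visited by `(u₁,v₁,t₁), …, (u_k,v_k,t_k)`. -/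
def visited : List (TemporalEdge V) → List V
  | [] => []
  | e :: p => e.src :: (e :: p).map TemporalEdge.dst

/-- A temporal path: a temporal walk that visits each node at most once. -/
def IsPath (T : TemporalNetwork V) (p : List (TemporalEdge V)) : Prop :=
  T.IsWalk p ∧ (visited p).Nodup

/-- `t_{i+1} ≤ t_i + δ` for all consecutive edges. -/
def IsRestless (δ : ℝ) (p : List (TemporalEdge V)) : Prop :=
  p.IsChain (fun e f => f.time ≤ e.time + δ)

/-- The sequence of edges starts at `s` and ends at `z`. -/
def Connects (s z : V) (p : List (TemporalEdge V)) : Prop :=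
  p.head?.map TemporalEdge.src = some s ∧ p.getLast?.map TemporalEdge.dst = some z

/-- The paths (for `stp`) or `δ`-restless walks (for `rtp δ`) from `s` to `z`. -/
def Admissible (T : TemporalNetwork V) (c : PathCriterion) (s z : V)
    (p : List (TemporalEdge V)) : Prop :=
  match c with
  | .stp => T.IsPath p ∧ Connects s z p
  | .rtp δ => T.IsWalk p ∧ IsRestless δ p ∧ Connects s z p

/-- The set `𝒫_{s,z}` of optimal paths: the admissible ones with the least number of edges. -/
def optimalPaths (T : TemporalNetwork V) (c : PathCriterion) (s z : V) :
    Set (List (TemporalEdge V)) :=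
  {p | T.Admissible c s z p ∧ ∀ q, T.Admissible c s z q → p.length ≤ q.length}

/-- The set of nodes internal to a path from `s` to `z`. -/
def internalNodes (s z : V) (p : List (TemporalEdge V)) : Set V :=
  {w | (∃ e ∈ p, e.src = w ∨ e.dst = w) ∧ w ≠ s ∧ w ≠ z}

/-- Timestamps increase along a walk, so no edge repeats and there are finitely many walks; in
particular the cardinalities below are counts of finite sets. -/
theorem finite_optimalPaths (T : TemporalNetwork V) (c : PathCriterion) (s z : V) :
    (T.optimalPaths c s z).Finite := by
  classical
  have hfin : {p : List (TemporalEdge V) | p.Nodup ∧ ∀ e ∈ p, e ∈ T.edges}.Finite := by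
    have h := (List.finite_length_le {e // e ∈ T.edges} T.edges.card).image
      (List.map Subtype.val)
    refine h.subset ?_
    rintro p ⟨hnd, hp⟩
    refine ⟨p.attach.map (fun e => ⟨e.1, hp e.1 e.2⟩), ?_, ?_⟩
    · have : p.toFinset ⊆ T.edges := fun e he => hp e (List.mem_toFinset.1 he)
      have h2 := Finset.card_le_card this
      rw [List.toFinset_card_of_nodup hnd] at h2
      simpa using h2
    · simp [List.map_map, Function.comp_def]
  refine hfin.subset ?_
  rintro p ⟨hp, -⟩
  have hw : T.IsWalk p := by
    cases c with
    | stp => exact hp.1.1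
    | rtp δ => exact hp.1
  refine ⟨?_, hw.2.1⟩
  have hc : p.IsChain (fun e f => e.time < f.time) := hw.2.2.imp (fun _ _ h => h.2)
  have : IsTrans (TemporalEdge V) (fun e f => e.time < f.time) := ⟨fun _ _ _ => lt_trans⟩
  exact (List.isChain_iff_pairwise.1 hc).imp (fun h he => by subst he; exact lt_irrefl _ h)

/-- `σ_{s,z}`, the number of optimal paths from `s` to `z`. -/
noncomputable def numPaths (T : TemporalNetwork V) (c : PathCriterion) (s z : V) : ℕ :=
  (T.optimalPaths c s z).ncard

/-- `σ_{s,z}(v)`, the number of optimal paths from `s` to `z` to which `v` is internal. -/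
noncomputable def numPathsThrough (T : TemporalNetwork V) (c : PathCriterion) (s z v : V) : ℕ :=
  {p ∈ T.optimalPaths c s z | v ∈ internalNodes s z p}.ncard

/-- The temporal betweenness centrality `b(v)`. A pair with `σ_{s,z} = 0` contributes `0`. -/
noncomputable def betweenness [Fintype V] [DecidableEq V] (T : TemporalNetwork V)
    (c : PathCriterion) (v : V) : ℝ :=
  1 / ((Fintype.card V : ℝ) * ((Fintype.card V : ℝ) - 1)) *
    ∑ d : NodePair V, (T.numPathsThrough c d.1.1 d.1.2 v : ℝ) / (T.numPaths c d.1.1 d.1.2 : ℝ)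

end TemporalNetwork

namespace ONBRA

variable {V : Type*}

/-- The empirical variance of `x₁, …, x_ℓ`. -/
noncomputable def empiricalVariance {ℓ : ℕ} (x : Fin ℓ → ℝ) : ℝ :=
  1 / ((ℓ : ℝ) * ((ℓ : ℝ) - 1)) * ∑ i : Fin ℓ, ∑ j ∈ Finset.Ioi i, (x i - x j) ^ 2

open Classical in
/-- Processing the pair `(s, z)` sampled in iteration `i`: if `z` is reached from `s`, then for
every node `v` internal to an optimal path the entry `(v, i)` of the matrix of estimates is set
to `σ_{s,z}(v) / σ_{s,z}`; all the other entries are kept. -/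
noncomputable def processSample {ℓ : ℕ} (T : TemporalNetwork V) (c : PathCriterion)
    (i : Fin ℓ) (d : NodePair V) (B : V → Fin ℓ → ℝ) : V → Fin ℓ → ℝ :=
  if (T.optimalPaths c d.1.1 d.1.2).Nonempty then
    fun v j =>
      if j = i ∧ ∃ p ∈ T.optimalPaths c d.1.1 d.1.2, v ∈ TemporalNetwork.internalNodes d.1.1 d.1.2 p
      then (T.numPathsThrough c d.1.1 d.1.2 v : ℝ) / (T.numPaths c d.1.1 d.1.2 : ℝ)
      else B v j
  else B

/-- The main loop: starting from the zero matrix, each of the `ℓ` iterations draws a fresh pair of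
distinct nodes uniformly at random and processes it. The result is the law of the final matrix of
estimates. -/
noncomputable def estimates [Fintype V] [DecidableEq V] [Nontrivial V] (T : TemporalNetwork V)
    (c : PathCriterion) (ℓ : ℕ) : PMF (V → Fin ℓ → ℝ) :=
  (List.finRange ℓ).foldlM
    (fun B i => (PMF.uniformOfFintype (NodePair V)).bind fun d =>
      PMF.pure (processSample T c i d B))
    (fun _ _ => 0)

/-- The returned estimates: row averages of the matrix. -/
noncomputable def average {ℓ : ℕ} (B : V → Fin ℓ → ℝ) (v : V) : ℝ :=
  1 / (ℓ : ℝ) * ∑ i : Fin ℓ, B v i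

/-- The returned accuracy `ε'`, computed from the matrix of estimates. -/
noncomputable def accuracy [Fintype V] {ℓ : ℕ} (η : ℝ) (B : V → Fin ℓ → ℝ) : ℝ :=
  ⨆ v : V, (Real.sqrt (2 * empiricalVariance (B v) * Real.log (4 * (Fintype.card V : ℝ) / η) / ℓ)
    + 7 * Real.log (4 * (Fintype.card V : ℝ) / η) / (3 * ((ℓ : ℝ) - 1)))

/-- The randomized algorithm: the law of the returned pair of the accuracy and the estimates. -/
noncomputable def onbra [Fintype V] [DecidableEq V] [Nontrivial V] (T : TemporalNetwork V)
    (c : PathCriterion) (η : ℝ) (ℓ : ℕ) : PMF (ℝ × (V → ℝ)) :=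
  (estimates T c ℓ).bind fun B => PMF.pure (accuracy η B, average B)

end ONBRA

/-!
The estimates of one node are independent samples from `[0, 1]` whose mean is its betweenness, so
Bernstein's inequality controls their average in terms of the true variance. The sample variance is
the average over all permutations of the sample of means over disjoint pairs, hence by convexity it
satisfies the same exponential moment bounds as such a mean, and it rarely underestimates the true
variance. Combining the two gives the empirical Bernstein inequality of Maurer and Pontil, in which
each node fails with probability at most `3 * η / (4 * n)`; a union bound over the `n` nodes
concludes.
-/

section Concentration

open MeasureTheory ProbabilityTheory

variable {Ω ι : Type*} {m : MeasurableSpace Ω} {P : Measure Ω}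

theorem exp_neg_le_one_sub_add_sq_div_two {x : ℝ} (hx : 0 ≤ x) :
    Real.exp (-x) ≤ 1 - x + x ^ 2 / 2 := by
  have hquad : 1 + x + x ^ 2 / 2 ≤ Real.exp x := Real.quadratic_le_exp_of_nonneg hx
  have hmul : 1 ≤ (1 - x + x ^ 2 / 2) * (1 + x + x ^ 2 / 2) := by nlinarith [sq_nonneg (x ^ 2)]
  rw [Real.exp_neg, inv_le_iff_one_le_mul₀ (Real.exp_pos x)]
  exact hmul.trans (by gcongr; nlinarith [sq_nonneg (1 - x)])

theorem exp_le_one_add_add_sq_div_of_nonneg {x : ℝ} (hx : 0 ≤ x) (hx3 : x < 3) :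
    Real.exp x ≤ 1 + x + x ^ 2 / (2 * (1 - x / 3)) := by
  have hexp : HasSum (fun n : ℕ => x ^ (n + 2) / (n + 2).factorial)
      (Real.exp x - (1 + x)) := by
    have h := NormedSpace.expSeries_div_hasSum_exp x
    rw [← Real.exp_eq_exp_ℝ, ← hasSum_nat_add_iff' 2] at h
    simpa [Finset.sum_range_succ] using h
  have hgeom : HasSum (fun n : ℕ => x ^ 2 / 2 * (x / 3) ^ n) (x ^ 2 / 2 * (1 - x / 3)⁻¹) :=
    (hasSum_geometric_of_lt_one (by positivity) (by linarith)).mul_left _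
  have hterm (n : ℕ) : x ^ (n + 2) / (n + 2).factorial ≤ x ^ 2 / 2 * (x / 3) ^ n := by
    have hfact : (2 * 3 ^ n : ℝ) ≤ (n + 2).factorial := by
      rw [add_comm n]
      exact_mod_cast Nat.factorial_mul_pow_le_factorial (m := 2) (n := n)
    calc x ^ (n + 2) / (n + 2).factorial ≤ x ^ (n + 2) / (2 * 3 ^ n) := by gcongr
      _ = x ^ 2 / 2 * (x / 3) ^ n := by rw [div_pow, pow_add]; ring
  have hle := hasSum_le hterm hexp hgeom
  rw [← div_eq_mul_inv, div_div] at hle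
  linarith

theorem exp_le_one_add_add_sq_div_of_le {x y : ℝ} (hxy : x ≤ y) (hy : 0 ≤ y) (hy3 : y < 3) :
    Real.exp x ≤ 1 + x + x ^ 2 / (2 * (1 - y / 3)) := by
  have hy1 : 0 < 1 - y / 3 := by linarith
  rcases le_total 0 x with hx | hx
  · refine (exp_le_one_add_add_sq_div_of_nonneg hx (hxy.trans_lt hy3)).trans ?_
    gcongr
  · calc Real.exp x ≤ 1 + x + x ^ 2 / 2 := by
          simpa using exp_neg_le_one_sub_add_sq_div_two (neg_nonneg.2 hx)
      _ ≤ 1 + x + x ^ 2 / (2 * (1 - y / 3)) := by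
          gcongr
          linarith

/-- Sub-gamma random variables, in the one-sided sense of Boucheron, Lugosi and Massart: the
moment generating function is bounded on `[0, 1/c)` only, with variance factor `v` and scale
`c`. For `c = 0` the bound holds on `[0, ∞)` and is the sub-Gaussian one. -/
structure HasSubgammaMGF (X : Ω → ℝ) (v c : ℝ) (P : Measure Ω) : Prop where
  integrable_exp_mul : ∀ s, 0 ≤ s → c * s < 1 → Integrable (fun ω => Real.exp (s * X ω)) P
  mgf_le : ∀ s, 0 ≤ s → c * s < 1 → mgf X P s ≤ Real.exp (v * s ^ 2 / (2 * (1 - c * s)))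

namespace HasSubgammaMGF

variable {X Y : Ω → ℝ} {v w c : ℝ}

theorem aemeasurable (h : HasSubgammaMGF X v c P) : AEMeasurable X P := by
  have hs : 0 < 1 / (|c| + 1) := by positivity
  refine aemeasurable_of_integrable_exp_mul hs.ne (h.integrable_exp_mul 0 le_rfl (by simp))
    (h.integrable_exp_mul _ hs.le ?_)
  rw [mul_one_div, div_lt_one (by positivity)]
  linarith [le_abs_self c]

theorem mono (h : HasSubgammaMGF X v c P) (hvw : v ≤ w) : HasSubgammaMGF X w c P where
  integrable_exp_mul := h.integrable_exp_mul
  mgf_le s hs hcs := (h.mgf_le s hs hcs).trans <| Real.exp_le_exp.2 <| by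
    have : 0 < 1 - c * s := by linarith
    gcongr

theorem zero [IsProbabilityMeasure P] : HasSubgammaMGF (fun _ : Ω => 0) 0 c P where
  integrable_exp_mul s _ _ := by simp
  mgf_le s _ _ := by simp [mgf]

theorem add (hX : HasSubgammaMGF X v c P) (hY : HasSubgammaMGF Y w c P) (hXY : IndepFun X Y P) :
    HasSubgammaMGF (X + Y) (v + w) c P where
  integrable_exp_mul s hs hcs := hXY.integrable_exp_mul_add (hX.integrable_exp_mul s hs hcs)
    (hY.integrable_exp_mul s hs hcs)
  mgf_le s hs hcs := by
    rw [hXY.mgf_add (hX.integrable_exp_mul s hs hcs).aestronglyMeasurable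
      (hY.integrable_exp_mul s hs hcs).aestronglyMeasurable, add_mul, add_div, Real.exp_add]
    exact mul_le_mul (hX.mgf_le s hs hcs) (hY.mgf_le s hs hcs) mgf_nonneg (Real.exp_pos _).le

theorem sum {X : ι → Ω → ℝ} {v : ι → ℝ} (hX : ∀ i, HasSubgammaMGF (X i) (v i) c P)
    (hindep : iIndepFun X P) (S : Finset ι) :
    HasSubgammaMGF (∑ i ∈ S, X i) (∑ i ∈ S, v i) c P := by
  classical
  have := hindep.isProbabilityMeasure
  induction S using Finset.induction_on with
  | empty => exact zero
  | insert i S hi ih =>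
    rw [Finset.sum_insert hi, Finset.sum_insert hi]
    exact (hX i).add ih
      (hindep.indepFun_finsetSum_of_notMem₀ (fun j => (hX j).aemeasurable) hi).symm

/-- Jensen's inequality takes the place of the product formula for independent summands, so that the
dependent terms of a U-statistic can be averaged. -/
theorem sum_smul {X : ι → Ω → ℝ} {S : Finset ι} {a : ι → ℝ}
    (h : ∀ i ∈ S, HasSubgammaMGF (X i) v c P) (ha : ∀ i ∈ S, 0 ≤ a i) (ha1 : ∑ i ∈ S, a i = 1) :
    HasSubgammaMGF (fun ω => ∑ i ∈ S, a i * X i ω) v c P := by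
  have hjensen (s : ℝ) (ω : Ω) : Real.exp (s * ∑ i ∈ S, a i * X i ω) ≤
      ∑ i ∈ S, a i * Real.exp (s * X i ω) := by
    have h := convexOn_exp.map_sum_le (p := fun i => s * X i ω) ha ha1 fun _ _ => Set.mem_univ _
    simpa only [smul_eq_mul, mul_left_comm _ s, ← Finset.mul_sum] using h
  have hint (s : ℝ) (hs : 0 ≤ s) (hcs : c * s < 1) :
      Integrable (fun ω => ∑ i ∈ S, a i * Real.exp (s * X i ω)) P :=
    integrable_finsetSum _ fun i hi => ((h i hi).integrable_exp_mul s hs hcs).const_mul _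
  have hmeas : AEMeasurable (fun ω => ∑ i ∈ S, a i * X i ω) P :=
    Finset.aemeasurable_fun_sum S fun i hi => (h i hi).aemeasurable.const_mul _
  have hint' (s : ℝ) (hs : 0 ≤ s) (hcs : c * s < 1) :
      Integrable (fun ω => Real.exp (s * ∑ i ∈ S, a i * X i ω)) P :=
    (hint s hs hcs).mono' (hmeas.const_mul s).exp.aestronglyMeasurable (.of_forall fun ω => by
      simpa only [Real.norm_eq_abs, Real.abs_exp] using hjensen s ω)
  refine ⟨hint', fun s hs hcs => ?_⟩
  calc mgf (fun ω => ∑ i ∈ S, a i * X i ω) P s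
      ≤ ∫ ω, ∑ i ∈ S, a i * Real.exp (s * X i ω) ∂P :=
        integral_mono (hint' s hs hcs) (hint s hs hcs) (hjensen s)
    _ = ∑ i ∈ S, a i * mgf (X i) P s := by
        rw [integral_finsetSum _ fun i hi => ((h i hi).integrable_exp_mul s hs hcs).const_mul _]
        simp only [integral_const_mul, mgf]
    _ ≤ ∑ i ∈ S, a i * Real.exp (v * s ^ 2 / (2 * (1 - c * s))) :=
        Finset.sum_le_sum fun i hi =>
          mul_le_mul_of_nonneg_left ((h i hi).mgf_le s hs hcs) (ha i hi)
    _ = Real.exp (v * s ^ 2 / (2 * (1 - c * s))) := by rw [← Finset.sum_mul, ha1, one_mul]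

/-- The Chernoff bound with the parameter `s = 2 * L / (a + 2 * c * L)`. -/
theorem measureReal_ge_le [IsFiniteMeasure P] (h : HasSubgammaMGF X v c P) {a L : ℝ} (ha : 0 < a)
    (hc : 0 ≤ c) (hL : 0 ≤ L) (hva : 2 * v * L ≤ a ^ 2) :
    P.real {ω | a + c * L ≤ X ω} ≤ Real.exp (-L) := by
  have : 0 < a + 2 * c * L := by positivity
  set s := 2 * L / (a + 2 * c * L) with hs
  have hs0 : 0 ≤ s := by positivity
  have hcs : 1 - c * s = a / (a + 2 * c * L) := by rw [hs]; field_simp; ring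
  have hcs1 : c * s < 1 := by
    have : 0 < 1 - c * s := hcs ▸ by positivity
    linarith
  have hexponent : -s * (a + c * L) + v * s ^ 2 / (2 * (1 - c * s)) ≤ -L := by
    have hsplit : -s * (a + c * L) + v * s ^ 2 / (2 * (1 - c * s)) =
        -L + L * (2 * v * L - a ^ 2) / (a * (a + 2 * c * L)) := by
      rw [hcs, hs]
      field_simp
      ring
    rw [hsplit, add_le_iff_nonpos_right]
    exact div_nonpos_of_nonpos_of_nonneg (mul_nonpos_of_nonneg_of_nonpos hL (by linarith))
      (by positivity)
  calc P.real {ω | a + c * L ≤ X ω} ≤ Real.exp (-s * (a + c * L)) * mgf X P s :=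
        measure_ge_le_exp_mul_mgf _ hs0 (h.integrable_exp_mul s hs0 hcs1)
    _ ≤ Real.exp (-s * (a + c * L)) * Real.exp (v * s ^ 2 / (2 * (1 - c * s))) := by
        gcongr
        exact h.mgf_le s hs0 hcs1
    _ ≤ Real.exp (-L) := by
        rw [← Real.exp_add]
        exact Real.exp_le_exp.2 hexponent

end HasSubgammaMGF

theorem measureReal_gt_le_of_forall_measureReal_ge_le [IsFiniteMeasure P] {X : Ω → ℝ} {a b : ℝ}
    (h : ∀ t, a < t → P.real {ω | t ≤ X ω} ≤ b) : P.real {ω | a < X ω} ≤ b := by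
  obtain ⟨u, hu_anti, hu_gt, hu_lim⟩ := exists_seq_strictAnti_tendsto a
  have hunion : {ω | a < X ω} = ⋃ n, {ω | u n ≤ X ω} :=
    (congrArg (X ⁻¹' ·) (iUnion_Ici_eq_Ioi_of_lt_of_tendsto hu_gt hu_lim).symm).trans
      Set.preimage_iUnion
  have hmono : Monotone fun n => {ω | u n ≤ X ω} := fun i j hij ω hω =>
    (hu_anti.antitone hij).trans hω
  rw [hunion]
  have hlim := (ENNReal.tendsto_toReal (measure_ne_top P _)).comp
    (tendsto_measure_iUnion_atTop (μ := P) hmono)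
  exact le_of_tendsto' hlim fun n => h _ (hu_gt n)

theorem HasSubgammaMGF.measureReal_gt_le [IsFiniteMeasure P] {X : Ω → ℝ} {v c L : ℝ}
    (h : HasSubgammaMGF X v c P) (hc : 0 ≤ c) (hL : 0 ≤ L) :
    P.real {ω | √(2 * v * L) + c * L < X ω} ≤ Real.exp (-L) := by
  refine measureReal_gt_le_of_forall_measureReal_ge_le fun t ht => ?_
  have ha : √(2 * v * L) < t - c * L := by linarith
  have ha0 : 0 < t - c * L := (Real.sqrt_nonneg _).trans_lt ha
  simpa only [sub_add_cancel] using
    h.measureReal_ge_le ha0 hc hL ((Real.sqrt_le_left ha0.le).1 ha.le)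

section Bounded

variable [IsProbabilityMeasure P] {X : Ω → ℝ}

theorem hasSubgammaMGF_of_ae_le {b : ℝ} (hX : MemLp X 2 P) (hmean : ∫ ω, X ω ∂P = 0)
    (hb : 0 ≤ b) (hXb : ∀ᵐ ω ∂P, X ω ≤ b) : HasSubgammaMGF X Var[X; P] (b / 3) P := by
  have hint (s : ℝ) (hs : 0 ≤ s) : Integrable (fun ω => Real.exp (s * X ω)) P := by
    refine (integrable_const (Real.exp (s * b))).mono'
      (hX.aemeasurable.const_mul s).exp.aestronglyMeasurable ?_
    filter_upwards [hXb] with ω hω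
    rw [Real.norm_eq_abs, Real.abs_exp]
    gcongr
  refine ⟨fun s hs _ => hint s hs, fun s hs hbs => ?_⟩
  have hX1 : Integrable X P := hX.integrable one_le_two
  have hX2 : Integrable (fun ω => X ω ^ 2) P := hX.integrable_sq
  set k : ℝ := s ^ 2 / (2 * (1 - b / 3 * s))
  have hpt : ∀ᵐ ω ∂P, Real.exp (s * X ω) ≤ 1 + s * X ω + k * X ω ^ 2 := by
    filter_upwards [hXb] with ω hω
    refine (exp_le_one_add_add_sq_div_of_le (mul_le_mul_of_nonneg_left hω hs)
      (mul_nonneg hs hb) (by linarith)).trans_eq ?_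
    rw [mul_pow, show s * b / 3 = b / 3 * s by ring]
    ring
  calc mgf X P s ≤ ∫ ω, (1 + s * X ω + k * X ω ^ 2) ∂P :=
        integral_mono_ae (hint s hs) (by fun_prop) hpt
    _ = 1 + k * Var[X; P] := by
        rw [integral_add (by fun_prop) (by fun_prop), integral_add (by fun_prop) (by fun_prop),
          integral_const_mul, integral_const_mul, hmean,
          variance_of_integral_eq_zero hX.aemeasurable hmean]
        simp
    _ ≤ Real.exp (Var[X; P] * s ^ 2 / (2 * (1 - b / 3 * s))) := by
        rw [add_comm, mul_comm, ← mul_div_assoc]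
        exact Real.add_one_le_exp _

theorem hasSubgammaMGF_integral_sub (hX : MemLp X 2 P) (hX0 : ∀ᵐ ω ∂P, 0 ≤ X ω) :
    HasSubgammaMGF (fun ω => ∫ ω', X ω' ∂P - X ω) (∫ ω, X ω ^ 2 ∂P) 0 P := by
  have hX1 : Integrable X P := hX.integrable one_le_two
  have hX2 : Integrable (fun ω => X ω ^ 2) P := hX.integrable_sq
  set μ := ∫ ω, X ω ∂P
  have hint (s : ℝ) (hs : 0 ≤ s) : Integrable (fun ω => Real.exp (s * (μ - X ω))) P := by
    refine (integrable_const (Real.exp (s * μ))).mono'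
      ((hX.aemeasurable.const_sub μ).const_mul s).exp.aestronglyMeasurable ?_
    filter_upwards [hX0] with ω hω
    rw [Real.norm_eq_abs, Real.abs_exp]
    gcongr
    linarith
  refine ⟨fun s hs _ => hint s hs, fun s hs _ => ?_⟩
  have hpt : ∀ᵐ ω ∂P, Real.exp (s * (μ - X ω)) ≤
      Real.exp (s * μ) * (1 - s * X ω + s ^ 2 / 2 * X ω ^ 2) := by
    filter_upwards [hX0] with ω hω
    rw [mul_sub, sub_eq_add_neg, Real.exp_add]
    gcongr
    refine (exp_neg_le_one_sub_add_sq_div_two (mul_nonneg hs hω)).trans_eq ?_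
    ring
  calc mgf (fun ω => μ - X ω) P s
      ≤ ∫ ω, Real.exp (s * μ) * (1 - s * X ω + s ^ 2 / 2 * X ω ^ 2) ∂P :=
        integral_mono_ae (hint s hs) (by fun_prop) hpt
    _ = Real.exp (s * μ) * (-(s * μ) + s ^ 2 / 2 * ∫ ω, X ω ^ 2 ∂P + 1) := by
        rw [integral_const_mul, integral_add (by fun_prop) (by fun_prop),
          integral_sub (by fun_prop) (by fun_prop), integral_const_mul, integral_const_mul]
        simp only [integral_const, probReal_univ, one_smul]
        ring
    _ ≤ Real.exp (s * μ) * Real.exp (-(s * μ) + s ^ 2 / 2 * ∫ ω, X ω ^ 2 ∂P) := by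
        gcongr
        exact Real.add_one_le_exp _
    _ = Real.exp ((∫ ω, X ω ^ 2 ∂P) * s ^ 2 / (2 * (1 - 0 * s))) := by
        rw [← Real.exp_add]
        ring_nf

end Bounded

theorem measureReal_sum_gt_le_of_iIndepFun {X : ι → Ω → ℝ} {b L : ℝ} (hindep : iIndepFun X P)
    (hX : ∀ i, MemLp (X i) 2 P) (hmean : ∀ i, ∫ ω, X i ω ∂P = 0) (hb : 0 ≤ b)
    (hXb : ∀ i, ∀ᵐ ω ∂P, X i ω ≤ b) (hL : 0 ≤ L) (S : Finset ι) :
    P.real {ω | √(2 * (∑ i ∈ S, Var[X i; P]) * L) + b / 3 * L < ∑ i ∈ S, X i ω} ≤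
      Real.exp (-L) := by
  have := hindep.isProbabilityMeasure
  have hsum := HasSubgammaMGF.sum
    (fun i => hasSubgammaMGF_of_ae_le (hX i) (hmean i) hb (hXb i)) hindep S
  simpa only [Finset.sum_apply] using hsum.measureReal_gt_le (by positivity) hL

theorem iIndepFun_prodMk_inl_inr {κ 𝓧 : Type*} [MeasurableSpace 𝓧] {X : κ ⊕ κ → Ω → 𝓧}
    (h : iIndepFun X P) (hX : ∀ i, AEMeasurable (X i) P) :
    iIndepFun (fun k ω => (X (.inl k) ω, X (.inr k) ω)) P := by
  classical
  have hP := h.isProbabilityMeasure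
  rw [iIndepFun_iff_measure_inter_preimage_eq_mul]
  intro S
  induction S using Finset.induction_on with
  | empty => simp
  | insert j S hj ih =>
    intro A hA
    have hblocks : IndepFun (fun ω => (X (.inl j) ω, X (.inr j) ω))
        (fun ω (k : S) => (X (.inl k) ω, X (.inr k) ω)) P := by
      have hdisj : Disjoint (({j} : Finset κ).disjSum {j}) (S.disjSum S) := by
        rw [Finset.disjoint_left]
        rintro (k | k) <;> simp +contextual [hj]
      refine (h.indepFun_finset₀ _ _ hdisj hX).comp
        (φ := fun x => (x ⟨.inl j, by simp⟩, x ⟨.inr j, by simp⟩))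
        (ψ := fun x (k : S) => (x ⟨.inl k, by simp⟩, x ⟨.inr k, by simp⟩)) ?_ ?_ <;> fun_prop
    have hprod := hblocks.measure_inter_preimage_eq_mul (A j) (⋂ k : S, (· k) ⁻¹' A k)
      (hA j (by simp)) (.iInter fun k => measurable_pi_apply k (hA k (by simp)))
    simp only [Set.preimage_iInter, Set.iInter_subtype, Set.preimage_preimage] at hprod
    rw [Finset.set_biInter_insert, Finset.prod_insert hj, ← ih fun k hk => hA k (by simp [hk])]
    exact hprod

section Pair

variable [IsProbabilityMeasure P] {X Y : Ω → ℝ}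

theorem integral_sq_sub_eq_variance_add_variance (hX : MemLp X 2 P) (hY : MemLp Y 2 P)
    (hXY : IndepFun X Y P) (hmean : ∫ ω, X ω ∂P = ∫ ω, Y ω ∂P) :
    ∫ ω, (X ω - Y ω) ^ 2 ∂P = Var[X; P] + Var[Y; P] := by
  have hmean_sub : ∫ ω, (X - Y) ω ∂P = 0 := by
    simp only [Pi.sub_apply]
    rw [integral_sub (hX.integrable one_le_two) (hY.integrable one_le_two), hmean, sub_self]
  have hvar := variance_of_integral_eq_zero (hX.sub hY).aemeasurable hmean_sub
  rw [variance_sub hX hY, hXY.covariance_eq_zero hX hY] at hvar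
  simpa using hvar.symm

theorem hasSubgammaMGF_variance_sub_sq_sub {v : ℝ} (hX : AEMeasurable X P) (hY : AEMeasurable Y P)
    (hX01 : ∀ᵐ ω ∂P, X ω ∈ Set.Icc 0 1) (hY01 : ∀ᵐ ω ∂P, Y ω ∈ Set.Icc 0 1)
    (hXY : IndepFun X Y P) (hmean : ∫ ω, X ω ∂P = ∫ ω, Y ω ∂P) (hvX : Var[X; P] = v)
    (hvY : Var[Y; P] = v) :
    HasSubgammaMGF (fun ω => v - (X ω - Y ω) ^ 2 / 2) (v / 2) 0 P := by
  have hX2 : MemLp X 2 P := memLp_of_bounded hX01 hX.aestronglyMeasurable 2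
  have hY2 : MemLp Y 2 P := memLp_of_bounded hY01 hY.aestronglyMeasurable 2
  have hZ01 : ∀ᵐ ω ∂P, (X ω - Y ω) ^ 2 / 2 ∈ Set.Icc 0 (1 / 2 : ℝ) := by
    filter_upwards [hX01, hY01] with ω ⟨hx0, hx1⟩ ⟨hy0, hy1⟩
    have hsq : (X ω - Y ω) ^ 2 ≤ 1 :=
      (sq_le_one_iff_abs_le_one _).2 (abs_le.2 ⟨by linarith, by linarith⟩)
    exact ⟨by positivity, by linarith⟩
  have hZ : MemLp (fun ω => (X ω - Y ω) ^ 2 / 2) 2 P :=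
    memLp_of_bounded hZ01 (by fun_prop) 2
  have hZmean : ∫ ω, (X ω - Y ω) ^ 2 / 2 ∂P = v := by
    rw [integral_div, integral_sq_sub_eq_variance_add_variance hX2 hY2 hXY hmean, hvX, hvY]
    ring
  have hZsq : ∫ ω, ((X ω - Y ω) ^ 2 / 2) ^ 2 ∂P ≤ v / 2 := by
    rw [← hZmean, ← integral_div]
    refine integral_mono_ae hZ.integrable_sq ((hZ.integrable one_le_two).div_const 2) ?_
    filter_upwards [hZ01] with ω ⟨hz0, hz1⟩
    nlinarith [mul_nonneg hz0 (sub_nonneg.2 hz1)]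
  have h := (hasSubgammaMGF_integral_sub hZ (hZ01.mono fun ω hω => hω.1)).mono hZsq
  rwa [hZmean] at h

end Pair

theorem card_offDiag_smul_sum_perm {ι M : Type*} [Fintype ι] [DecidableEq ι] [AddCommMonoid M]
    (F : ι → ι → M) {a b : ι} (hab : a ≠ b) :
    (Finset.univ : Finset ι).offDiag.card • ∑ π : Equiv.Perm ι, F (π a) (π b) =
      Fintype.card (Equiv.Perm ι) • ∑ p ∈ (Finset.univ : Finset ι).offDiag, F p.1 p.2 := by
  have htrans : ∀ p ∈ (Finset.univ : Finset ι).offDiag,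
      ∑ π : Equiv.Perm ι, F (π p.1) (π p.2) = ∑ π : Equiv.Perm ι, F (π a) (π b) := by
    rintro ⟨c, d⟩ hcd
    obtain ⟨ρ, rfl, rfl⟩ : ∃ ρ : Equiv.Perm ι, ρ a = c ∧ ρ b = d :=
      (MulAction.is_two_pretransitive_iff).1 (Equiv.Perm.isMultiplyPretransitive ι 2) hab
        (by simpa using hcd)
    exact Equiv.sum_comp (Equiv.mulRight ρ) fun π : Equiv.Perm ι => F (π a) (π b)
  have hperm (π : Equiv.Perm ι) : ∑ p ∈ (Finset.univ : Finset ι).offDiag, F (π p.1) (π p.2) =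
      ∑ p ∈ (Finset.univ : Finset ι).offDiag, F p.1 p.2 :=
    Finset.sum_equiv (π.prodCongr π) (by simp) (by simp)
  rw [← Finset.sum_const, ← Finset.sum_congr rfl htrans, Finset.sum_comm,
    Finset.sum_congr rfl fun π _ => hperm π, Finset.sum_const, Finset.card_univ]

namespace ONBRA

variable {n : ℕ}

theorem empiricalVariance_nonneg (x : Fin n → ℝ) : 0 ≤ empiricalVariance x := by
  refine mul_nonneg ?_ (Finset.sum_nonneg fun i _ => Finset.sum_nonneg fun j _ => sq_nonneg _)
  rcases n with _ | n
  · simp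
  · push_cast
    rw [add_sub_cancel_right]
    positivity

theorem empiricalVariance_eq_sum_offDiag (x : Fin n → ℝ) :
    empiricalVariance x = 1 / ((n : ℝ) * (n - 1)) *
      ∑ p ∈ (Finset.univ : Finset (Fin n)).offDiag, (x p.1 - x p.2) ^ 2 / 2 := by
  have hsum : ∑ p ∈ (Finset.univ : Finset (Fin n)).offDiag, (x p.1 - x p.2) ^ 2 / 2 =
      ∑ i, ∑ j ∈ {i}ᶜ, (x j - x i) ^ 2 / 2 :=
    Finset.sum_finset_product_right' (f := fun j i => (x j - x i) ^ 2 / 2) _ _ _ (by simp)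
  rw [empiricalVariance, hsum,
    ← Finset.sum_sum_Ioi_add_eq_sum_sum_off_diag fun j i => (x j - x i) ^ 2 / 2]
  congr! 3 with i - j
  ring

/-- The average over all permutations of the sample turns the sample variance, which involves all
pairs of sample points, into means over disjoint pairs. -/
theorem card_mul_empiricalVariance_eq_sum_perm {κ : Type*} [Fintype κ] (e : κ ⊕ κ ↪ Fin n)
    (x : Fin n → ℝ) :
    Fintype.card κ * empiricalVariance x = ∑ π : Equiv.Perm (Fin n),
      (1 / Fintype.card (Equiv.Perm (Fin n)) : ℝ) *
        ∑ k, (x (π (e (.inl k))) - x (π (e (.inr k)))) ^ 2 / 2 := by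
  have hpair (k : κ) : ∑ π : Equiv.Perm (Fin n),
      (x (π (e (.inl k))) - x (π (e (.inr k)))) ^ 2 / 2 =
        Fintype.card (Equiv.Perm (Fin n)) * empiricalVariance x := by
    have hne : e (.inl k) ≠ e (.inr k) := by simp
    have h := card_offDiag_smul_sum_perm (fun i j => (x i - x j) ^ 2 / 2) hne
    have hcard : ((Finset.univ : Finset (Fin n)).offDiag.card : ℝ) = n * (n - 1) := by
      rw [Finset.offDiag_card, Nat.cast_sub (Nat.le_mul_self _)]
      simp
      ring
    have hcard_ne : (n : ℝ) * (n - 1) ≠ 0 := by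
      rw [← hcard, Nat.cast_ne_zero, Finset.card_ne_zero]
      exact ⟨(e (.inl k), e (.inr k)), by simp⟩
    rw [nsmul_eq_mul, nsmul_eq_mul, hcard] at h
    rw [empiricalVariance_eq_sum_offDiag, mul_left_comm, ← h, ← mul_assoc,
      one_div_mul_cancel hcard_ne, one_mul]
  rw [← Finset.mul_sum, Finset.sum_comm, Finset.sum_congr rfl fun k _ => hpair k]
  simp only [Finset.sum_const, Finset.card_univ, nsmul_eq_mul]
  field_simp

section Sample

variable {X : Fin n → Ω → ℝ} {μ v L : ℝ}

theorem hasSubgammaMGF_sum_pairs {κ : Type*} [Fintype κ] (e : κ ⊕ κ ↪ Fin n)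
    (hindep : iIndepFun X P) (hX : ∀ i, AEMeasurable (X i) P)
    (hX01 : ∀ i, ∀ᵐ ω ∂P, X i ω ∈ Set.Icc 0 1) (hmean : ∀ i, ∫ ω, X i ω ∂P = μ)
    (hvar : ∀ i, Var[X i; P] = v) :
    HasSubgammaMGF (fun ω => ∑ k, (v - (X (e (.inl k)) ω - X (e (.inr k)) ω) ^ 2 / 2))
      (Fintype.card κ * (v / 2)) 0 P := by
  have := hindep.isProbabilityMeasure
  have hprecomp : iIndepFun (fun i => X (e i)) P := hindep.precomp e.injective
  have hpairs := (iIndepFun_prodMk_inl_inr hprecomp fun i => hX _).comp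
    (fun _ p => v - (p.1 - p.2) ^ 2 / 2) (fun _ => by fun_prop)
  have hsum := HasSubgammaMGF.sum (fun k => hasSubgammaMGF_variance_sub_sq_sub (hX _) (hX _)
    (hX01 _) (hX01 _) (hindep.indepFun (by simp)) ((hmean _).trans (hmean _).symm)
    (hvar _) (hvar (e (.inr k)))) hpairs Finset.univ
  rw [Finset.sum_const, Finset.card_univ, nsmul_eq_mul] at hsum
  convert hsum using 2
  simp

theorem hasSubgammaMGF_variance_sub_empiricalVariance {κ : Type*} [Fintype κ] (e : κ ⊕ κ ↪ Fin n)
    (hindep : iIndepFun X P) (hX : ∀ i, AEMeasurable (X i) P)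
    (hX01 : ∀ i, ∀ᵐ ω ∂P, X i ω ∈ Set.Icc 0 1) (hmean : ∀ i, ∫ ω, X i ω ∂P = μ)
    (hvar : ∀ i, Var[X i; P] = v) :
    HasSubgammaMGF (fun ω => Fintype.card κ * (v - empiricalVariance fun i => X i ω))
      (Fintype.card κ * (v / 2)) 0 P := by
  have hweights : ∑ _π : Equiv.Perm (Fin n), (1 / Fintype.card (Equiv.Perm (Fin n)) : ℝ) = 1 := by
    simp [Finset.card_univ]
  have havg := HasSubgammaMGF.sum_smul (S := Finset.univ)
    (fun (π : Equiv.Perm (Fin n)) _ => hasSubgammaMGF_sum_pairs (e.trans π.toEmbedding) hindep hX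
      hX01 hmean hvar) (fun _ _ => by positivity) hweights
  convert havg using 2 with ω
  simp only [Finset.sum_sub_distrib, mul_sub, ← Finset.sum_mul, hweights,
    card_mul_empiricalVariance_eq_sum_perm e]
  simp

theorem measureReal_empiricalVariance_lt_le (hn : 2 ≤ n) (hindep : iIndepFun X P)
    (hX : ∀ i, AEMeasurable (X i) P)
    (hX01 : ∀ i, ∀ᵐ ω ∂P, X i ω ∈ Set.Icc 0 1) (hmean : ∀ i, ∫ ω, X i ω ∂P = μ)
    (hvar : ∀ i, Var[X i; P] = v) (hL : 0 ≤ L) :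
    P.real {ω | empiricalVariance (fun i => X i ω) < v - √v * √(2 * L / (n - 1))} ≤
      Real.exp (-L) := by
  have := hindep.isProbabilityMeasure
  obtain ⟨m, hm0, hmn, hnm⟩ : ∃ m : ℕ, 0 < m ∧ m + m ≤ n ∧ n ≤ 2 * m + 1 :=
    ⟨n / 2, by omega, by omega, by omega⟩
  have : (0 : ℝ) < m := by exact_mod_cast hm0
  have hn1 : 0 < (n : ℝ) - 1 := by
    have : (2 : ℝ) ≤ n := by exact_mod_cast hn
    linarith
  have hnm' : (n : ℝ) - 1 ≤ 2 * m := by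
    have : (n : ℝ) ≤ 2 * m + 1 := by exact_mod_cast hnm
    linarith
  have hv : 0 ≤ v := hvar ⟨0, by omega⟩ ▸ variance_nonneg _ _
  have htail := (hasSubgammaMGF_variance_sub_empiricalVariance
    (finSumFinEquiv.toEmbedding.trans (Fin.castLEEmb hmn)) hindep hX hX01 hmean
    hvar).measureReal_gt_le le_rfl hL
  have hsqrt : √(2 * (m * (v / 2)) * L) ≤ m * (√v * √(2 * L / (n - 1))) := by
    rw [← Real.sqrt_mul hv]
    refine Real.sqrt_le_iff.2 ⟨by positivity, ?_⟩
    rw [mul_pow, Real.sq_sqrt (by positivity),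
      show (m : ℝ) ^ 2 * (v * (2 * L / (n - 1))) = m ^ 2 * (v * (2 * L)) / (n - 1) by ring,
      le_div_iff₀ hn1]
    calc 2 * (m * (v / 2)) * L * (n - 1) = m * v * L * (n - 1) := by ring
      _ ≤ m * v * L * (2 * m) := by gcongr
      _ = m ^ 2 * (v * (2 * L)) := by ring
  refine (measureReal_mono fun ω hω => ?_).trans htail
  rw [Set.mem_ofPred_eq] at hω ⊢
  rw [Fintype.card_fin, zero_mul, add_zero]
  refine hsqrt.trans_lt ?_
  gcongr
  linarith

theorem measureReal_sum_sub_mean_gt_le (hindep : iIndepFun X P)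
    (hX : ∀ i, AEMeasurable (X i) P) (hX01 : ∀ i, ∀ᵐ ω ∂P, X i ω ∈ Set.Icc 0 1)
    (hmean : ∀ i, ∫ ω, X i ω ∂P = μ) (hvar : ∀ i, Var[X i; P] = v) (hL : 0 ≤ L) :
    P.real {ω | √(2 * (n * v) * L) + L / 3 < ∑ i, (X i ω - μ)} ≤ Real.exp (-L) := by
  have := hindep.isProbabilityMeasure
  have hX2 (i : Fin n) : MemLp (X i) 2 P :=
    memLp_of_bounded (hX01 i) (hX i).aestronglyMeasurable 2
  have hcentred (i : Fin n) : ∫ ω, (X i ω - μ) ∂P = 0 := by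
    rw [integral_sub ((hX2 i).integrable one_le_two) (integrable_const μ), hmean i]
    simp
  have hle_one (i : Fin n) : ∀ᵐ ω ∂P, X i ω - μ ≤ 1 := by
    have hμ : 0 ≤ μ := hmean i ▸ integral_nonneg_of_ae ((hX01 i).mono fun ω hω => hω.1)
    filter_upwards [hX01 i] with ω hω
    linarith [hω.2]
  have h := measureReal_sum_gt_le_of_iIndepFun
    (hindep.comp (fun _ x => x - μ) fun _ => by fun_prop)
    (fun i => (hX2 i).sub (memLp_const μ)) hcentred zero_le_one hle_one hL Finset.univ
  have hvar' (i : Fin n) : Var[(fun x => x - μ) ∘ X i; P] = v :=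
    (variance_sub_const (hX i).aestronglyMeasurable μ).trans (hvar i)
  simpa [hvar', inv_mul_eq_div] using h

theorem measureReal_sum_mean_sub_gt_le (hindep : iIndepFun X P)
    (hX : ∀ i, AEMeasurable (X i) P) (hX01 : ∀ i, ∀ᵐ ω ∂P, X i ω ∈ Set.Icc 0 1)
    (hmean : ∀ i, ∫ ω, X i ω ∂P = μ) (hvar : ∀ i, Var[X i; P] = v) (hL : 0 ≤ L) :
    P.real {ω | √(2 * (n * v) * L) + L / 3 < ∑ i, (μ - X i ω)} ≤ Real.exp (-L) := by
  have := hindep.isProbabilityMeasure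
  have hX1 (i : Fin n) : Integrable (X i) P :=
    (memLp_of_bounded (hX01 i) (hX i).aestronglyMeasurable 1).integrable le_rfl
  have h := measureReal_sum_sub_mean_gt_le (X := fun i ω => 1 - X i ω) (μ := 1 - μ) (v := v)
    (hindep.comp (fun _ x => 1 - x) fun _ => by fun_prop) (fun i => (hX i).const_sub 1)
    (fun i => (hX01 i).mono fun ω hω => ⟨sub_nonneg.2 hω.2, sub_le_self 1 hω.1⟩)
    (fun i => by rw [integral_sub (integrable_const 1) (hX1 i), hmean i]; simp)
    (fun i => (variance_const_sub (hX i).aestronglyMeasurable 1).trans (hvar i)) hL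
  simpa only [sub_sub_sub_cancel_left] using h

theorem one_div_mul_le_of_sqrt_variance_sub_le {x V : ℝ} (hn : 2 ≤ n) (hv : 0 ≤ v) (hV : 0 ≤ V)
    (hL : 0 ≤ L) (hvV : v - √v * √(2 * L / (n - 1)) ≤ V)
    (hx : x ≤ √(2 * (n * v) * L) + L / 3) :
    1 / n * x ≤ √(2 * V * L / n) + 7 * L / (3 * (n - 1)) := by
  have hn' : (2 : ℝ) ≤ n := by exact_mod_cast hn
  have hn1 : 0 < (n : ℝ) - 1 := by linarith
  set c : ℝ := √(2 * L / (n - 1))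
  set q : ℝ := √(2 * L / n)
  have hc0 : 0 ≤ c := Real.sqrt_nonneg _
  have hcsq : c ^ 2 = 2 * L / (n - 1) := Real.sq_sqrt (by positivity)
  have hqc : q ≤ c := Real.sqrt_le_sqrt (by gcongr; linarith)
  have hsd : √v ≤ √V + c := by
    by_contra! h
    nlinarith [Real.sq_sqrt hv, Real.sq_sqrt hV, Real.sqrt_nonneg V]
  have hsqrt_v : √(2 * (n * v) * L) = n * (√v * q) := by
    rw [show 2 * (n * v) * L = n ^ 2 * (v * (2 * L / n)) by field_simp,
      Real.sqrt_mul (by positivity), Real.sqrt_sq (by positivity), Real.sqrt_mul hv]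
  have hsqrt_V : √(2 * V * L / n) = √V * q := by
    rw [show 2 * V * L / n = V * (2 * L / n) by ring, Real.sqrt_mul hV]
  calc 1 / n * x ≤ 1 / n * (n * (√v * q) + L / 3) := by
        rw [← hsqrt_v]
        gcongr
    _ = √v * q + L / (3 * n) := by field_simp
    _ ≤ (√V + c) * q + L / (3 * (n - 1)) := by
        gcongr
        linarith
    _ ≤ √V * q + c ^ 2 + L / (3 * (n - 1)) := by
        rw [add_mul, sq]
        gcongr
    _ = √(2 * V * L / n) + 7 * L / (3 * (n - 1)) := by
        rw [hsqrt_V, hcsq]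
        field_simp
        ring

theorem measureReal_abs_mean_sub_gt_le (hn : 2 ≤ n) (hindep : iIndepFun X P)
    (hX : ∀ i, AEMeasurable (X i) P) (hX01 : ∀ i, ∀ᵐ ω ∂P, X i ω ∈ Set.Icc 0 1)
    (hmean : ∀ i, ∫ ω, X i ω ∂P = μ) (hvar : ∀ i, Var[X i; P] = v) (hL : 0 ≤ L) :
    P.real {ω | √(2 * empiricalVariance (fun i => X i ω) * L / n) + 7 * L / (3 * (n - 1)) <
      |1 / (n : ℝ) * ∑ i, X i ω - μ|} ≤ 3 * Real.exp (-L) := by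
  have := hindep.isProbabilityMeasure
  have hv : 0 ≤ v := hvar ⟨0, by omega⟩ ▸ variance_nonneg _ _
  set above : Set Ω := {ω | √(2 * (n * v) * L) + L / 3 < ∑ i, (X i ω - μ)}
  set below : Set Ω := {ω | √(2 * (n * v) * L) + L / 3 < ∑ i, (μ - X i ω)}
  set smallVar : Set Ω :=
    {ω | empiricalVariance (fun i => X i ω) < v - √v * √(2 * L / (n - 1))}
  have hsub : {ω | √(2 * empiricalVariance (fun i => X i ω) * L / n) + 7 * L / (3 * (n - 1)) <
      |1 / (n : ℝ) * ∑ i, X i ω - μ|} ⊆ above ∪ below ∪ smallVar := by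
    intro ω hω
    by_contra hgood
    simp only [above, below, smallVar, Set.mem_union, Set.mem_ofPred_eq, not_or, not_lt]
      at hgood hω
    obtain ⟨⟨habove, hbelow⟩, hsmallVar⟩ := hgood
    have hV := empiricalVariance_nonneg fun i => X i ω
    have hupper := one_div_mul_le_of_sqrt_variance_sub_le hn hv hV hL hsmallVar habove
    have hlower := one_div_mul_le_of_sqrt_variance_sub_le hn hv hV hL hsmallVar hbelow
    have hmean_sum : 1 / (n : ℝ) * ∑ _i : Fin n, μ = μ := by
      simp
      field_simp
    rw [Finset.sum_sub_distrib, mul_sub, hmean_sum] at hupper hlower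
    exact hω.not_ge (abs_sub_le_iff.2 ⟨hupper, hlower⟩)
  calc P.real _ ≤ P.real above + P.real below + P.real smallVar :=
        (measureReal_mono hsub).trans <|
          (measureReal_union_le _ _).trans <| by gcongr; exact measureReal_union_le _ _
    _ ≤ Real.exp (-L) + Real.exp (-L) + Real.exp (-L) := by
        gcongr
        · exact measureReal_sum_sub_mean_gt_le hindep hX hX01 hmean hvar hL
        · exact measureReal_sum_mean_sub_gt_le hindep hX hX01 hmean hvar hL
        · exact measureReal_empiricalVariance_lt_le hn hindep hX hX01 hmean hvar hL
    _ = 3 * Real.exp (-L) := by ring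

end Sample

theorem one_sub_lt_measureReal_iSup_abs_average_sub_le_accuracy {V : Type*} [Fintype V] [Nonempty V]
    {X : V → Fin n → Ω → ℝ} {μ σ : V → ℝ} {η : ℝ} (hn : 2 ≤ n) (hη₀ : 0 < η)
    (hη₁ : η < 1) (hindep : ∀ v, iIndepFun (X v) P) (hX : ∀ v i, AEMeasurable (X v i) P)
    (hX01 : ∀ v i, ∀ᵐ ω ∂P, X v i ω ∈ Set.Icc 0 1) (hmean : ∀ v i, ∫ ω, X v i ω ∂P = μ v)
    (hvar : ∀ v i, Var[X v i; P] = σ v) :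
    1 - η < P.real {ω | ⨆ v, |average (fun v i => X v i ω) v - μ v| ≤
      accuracy η fun v i => X v i ω} := by
  have := (hindep (Classical.arbitrary V)).isProbabilityMeasure
  set L : ℝ := Real.log (4 * Fintype.card V / η)
  set bad : V → Set Ω := fun v =>
    {ω | √(2 * empiricalVariance (fun i => X v i ω) * L / n) + 7 * L / (3 * (n - 1)) <
      |1 / (n : ℝ) * ∑ i, X v i ω - μ v|}
  have hV : (1 : ℝ) ≤ Fintype.card V := by exact_mod_cast Fintype.card_pos
  have hL : 0 ≤ L := Real.log_nonneg (by rw [one_le_div hη₀]; linarith)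
  have hexp : Real.exp (-L) = η / (4 * Fintype.card V) := by
    rw [Real.exp_neg, Real.exp_log (by positivity), inv_div]
  have hbad : P.real (⋃ v, bad v) ≤ 3 / 4 * η :=
    calc P.real (⋃ v, bad v) ≤ ∑ v, P.real (bad v) := measureReal_iUnion_fintype_le _
      _ ≤ ∑ _v : V, 3 * Real.exp (-L) := Finset.sum_le_sum fun v _ =>
        measureReal_abs_mean_sub_gt_le hn (hindep v) (hX v) (hX01 v) (hmean v) (hvar v) hL
      _ = 3 / 4 * η := by
        rw [Finset.sum_const, Finset.card_univ, nsmul_eq_mul, hexp]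
        field_simp
  have hgood : (⋃ v, bad v)ᶜ ⊆ {ω | ⨆ v, |average (fun v i => X v i ω) v - μ v| ≤
      accuracy η fun v i => X v i ω} := by
    intro ω hω
    rw [Set.mem_ofPred_eq, accuracy]
    exact ciSup_mono (Set.finite_range _).bddAbove fun v =>
      not_lt.1 fun h => hω (Set.mem_iUnion.2 ⟨v, h⟩)
  calc 1 - η < 1 - P.real (⋃ v, bad v) := by linarith
    _ ≤ P.real (⋃ v, bad v)ᶜ := by
      have h := measureReal_union_le (μ := P) (⋃ v, bad v) (⋃ v, bad v)ᶜ
      rw [Set.union_compl_self, probReal_univ] at h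
      linarith
    _ ≤ _ := measureReal_mono hgood

end ONBRA

end Concentration

section Algorithm

open MeasureTheory ProbabilityTheory

section Loop

variable {ι D : Type*} [Fintype ι] [Countable D] [MeasurableSpace D] [MeasurableSingletonClass D]
  {p : ι → PMF D} {q : PMF (ι → D)}

theorem toMeasure_map_update_apply_pi [DecidableEq ι]
    (hq : q.toMeasure = Measure.pi fun i => (p i).toMeasure) (i : ι) (d : D) {s : ι → Set D}
    (hs : ∀ j, MeasurableSet (s j)) :
    (q.map fun ω => Function.update ω i d).toMeasure (Set.univ.pi s) =
      (s i).indicator (fun _ => ∏ j ∈ {i}ᶜ, (p j).toMeasure (s j)) d := by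
  have hpre : (fun ω => Function.update ω i d) ⁻¹' Set.univ.pi s =
      {_ω | d ∈ s i} ∩ Set.univ.pi (Function.update s i Set.univ) := by
    ext ω
    simp only [Set.mem_preimage, Set.mem_univ_pi, Set.mem_inter_iff, Set.mem_ofPred_eq]
    grind [Function.update_apply]
  rw [← PMF.toMeasure_map _ _ .of_discrete, Measure.map_apply .of_discrete (.univ_pi hs), hq,
    hpre]
  by_cases hd : d ∈ s i
  · have hcompl : ∏ j ∈ {i}ᶜ, (p j).toMeasure (Function.update s i Set.univ j) =
        ∏ j ∈ {i}ᶜ, (p j).toMeasure (s j) :=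
      Finset.prod_congr rfl fun j hj => by rw [Function.update_of_ne (by simpa using hj)]
    simp [hd, Fintype.prod_eq_mul_prod_compl i, hcompl]
  · simp [hd]

theorem bind_map_update_eq [DecidableEq ι]
    (hq : q.toMeasure = Measure.pi fun i => (p i).toMeasure) (i : ι) :
    ((p i).bind fun d => q.map fun ω => Function.update ω i d) = q := by
  apply PMF.toMeasure_injective
  rw [hq]
  refine (Measure.pi_eq fun s hs => ?_).symm
  rw [PMF.toMeasure_bind_apply _ _ _ (.univ_pi hs), Fintype.prod_eq_mul_prod_compl i,
    PMF.toMeasure_apply _ (hs i), ← ENNReal.tsum_mul_right]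
  refine tsum_congr fun d => ?_
  rw [toMeasure_map_update_apply_pi hq i d hs]
  by_cases hd : d ∈ s i <;> simp [hd]

/-- Overwriting one coordinate of the independent draws by a fresh one does not change their law, so
all the draws can be made in advance. -/
theorem foldlM_bind_pure_eq_map_foldl {β : Type*}
    (hq : q.toMeasure = Measure.pi fun i => (p i).toMeasure) (F : ι → D → β → β) {l : List ι}
    (hl : l.Nodup) (b : β) :
    l.foldlM (fun b i => (p i).bind fun d => PMF.pure (F i d b)) b =
      q.map fun ω => l.foldl (fun b i => F i (ω i) b) b := by
  classical
  induction l generalizing b with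
  | nil => exact (PMF.map_const _ _).symm
  | cons i l ih =>
    obtain ⟨hil, hl⟩ := List.nodup_cons.1 hl
    have hcongr (d : D) (ω : ι → D) :
        (i :: l).foldl (fun b j => F j (Function.update ω i d j) b) b =
          l.foldl (fun b j => F j (ω j) b) (F i d b) := by
      rw [List.foldl_cons, Function.update_self]
      refine List.foldl_ext _ _ _ fun b j hj => ?_
      rw [Function.update_of_ne (ne_of_mem_of_not_mem hj hil)]
    calc (i :: l).foldlM (fun b i => (p i).bind fun d => PMF.pure (F i d b)) b
        = (p i).bind fun d => q.map fun ω => l.foldl (fun b j => F j (ω j) b) (F i d b) := by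
          rw [List.foldlM_cons]
          change PMF.bind _ _ = _
          simp only [PMF.bind_bind, PMF.pure_bind, ih hl]
      _ = ((p i).bind fun d => q.map fun ω => Function.update ω i d).map
            fun ω => (i :: l).foldl (fun b j => F j (ω j) b) b := by
          simp only [PMF.map_bind, PMF.map_comp, Function.comp_def, hcongr]
      _ = q.map fun ω => (i :: l).foldl (fun b j => F j (ω j) b) b := by
          rw [bind_map_update_eq hq]

end Loop

namespace ONBRA

variable {V : Type*} {ℓ : ℕ} (T : TemporalNetwork V) (c : PathCriterion)

/-- The fraction `σ_{s,z}(v) / σ_{s,z}` of the optimal paths to which `v` is internal, as a function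
of the pair `d = (s, z)`. It is `0` when `σ_{s,z} = 0`. -/
noncomputable def pathFraction (v : V) (d : NodePair V) : ℝ :=
  (T.numPathsThrough c d.1.1 d.1.2 v : ℝ) / (T.numPaths c d.1.1 d.1.2 : ℝ)

theorem pathFraction_mem_Icc (v : V) (d : NodePair V) :
    pathFraction T c v d ∈ Set.Icc (0 : ℝ) 1 := by
  have hle : T.numPathsThrough c d.1.1 d.1.2 v ≤ T.numPaths c d.1.1 d.1.2 :=
    Set.ncard_le_ncard (Set.sep_subset _ _) (T.finite_optimalPaths c _ _)
  exact ⟨div_nonneg (Nat.cast_nonneg _) (Nat.cast_nonneg _),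
    div_le_one_of_le₀ (Nat.cast_le.2 hle) (Nat.cast_nonneg _)⟩

theorem pathFraction_eq_zero {v : V} {d : NodePair V}
    (h : ¬ ∃ p ∈ T.optimalPaths c d.1.1 d.1.2,
      v ∈ TemporalNetwork.internalNodes d.1.1 d.1.2 p) :
    pathFraction T c v d = 0 := by
  have hempty : {p ∈ T.optimalPaths c d.1.1 d.1.2 |
      v ∈ TemporalNetwork.internalNodes d.1.1 d.1.2 p} = ∅ :=
    Set.eq_empty_of_forall_notMem fun p hp => h ⟨p, hp⟩
  simp [pathFraction, TemporalNetwork.numPathsThrough, hempty]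

theorem processSample_apply_self (i : Fin ℓ) (d : NodePair V) {B : V → Fin ℓ → ℝ} {v : V}
    (hB : B v i = 0) : processSample T c i d B v i = pathFraction T c v d := by
  by_cases h : ∃ p ∈ T.optimalPaths c d.1.1 d.1.2,
      v ∈ TemporalNetwork.internalNodes d.1.1 d.1.2 p
  · have hne : (T.optimalPaths c d.1.1 d.1.2).Nonempty := ⟨h.choose, h.choose_spec.1⟩
    rw [processSample, if_pos hne, if_pos ⟨rfl, h⟩, pathFraction]
  · rw [processSample, pathFraction_eq_zero T c h]
    split_ifs with hne
    · exact (if_neg fun hi => h hi.2).trans hB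
    · exact hB

theorem processSample_apply_of_ne {i j : Fin ℓ} (hji : j ≠ i) (d : NodePair V)
    (B : V → Fin ℓ → ℝ) (v : V) : processSample T c i d B v j = B v j := by
  unfold processSample
  split_ifs with hne
  · exact if_neg fun hj => hji hj.1
  · rfl

theorem foldl_processSample_apply (ω : Fin ℓ → NodePair V) {l : List (Fin ℓ)} (hl : l.Nodup)
    {B : V → Fin ℓ → ℝ} (hB : ∀ v, ∀ i ∈ l, B v i = 0) (v : V) (j : Fin ℓ) :
    l.foldl (fun B i => processSample T c i (ω i) B) B v j =
      if j ∈ l then pathFraction T c v (ω j) else B v j := by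
  induction l generalizing B with
  | nil => simp
  | cons i l ih =>
    obtain ⟨hil, hl⟩ := List.nodup_cons.1 hl
    have hB' : ∀ v, ∀ k ∈ l, processSample T c i (ω i) B v k = 0 := fun v k hk => by
      rw [processSample_apply_of_ne T c (ne_of_mem_of_not_mem hk hil)]
      exact hB v k (List.mem_cons_of_mem _ hk)
    rw [List.foldl_cons, ih hl hB']
    by_cases hji : j = i
    · subst hji
      simp [hil, processSample_apply_self T c j (ω j) (hB v j List.mem_cons_self)]
    · simp [hji, processSample_apply_of_ne T c hji]

variable [Fintype V] [DecidableEq V]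

theorem card_nodePair :
    (Fintype.card (NodePair V) : ℝ) = Fintype.card V * (Fintype.card V - 1) := by
  have hoffDiag : Fintype.card (NodePair V) = (Finset.univ : Finset V).offDiag.card := by
    rw [Fintype.card_subtype]
    congr 1
    ext p
    simp
  rw [hoffDiag, Finset.offDiag_card, Finset.card_univ, Nat.cast_sub (Nat.le_mul_self _),
    Nat.cast_mul]
  ring

variable [Nontrivial V] [MeasurableSpace (NodePair V)] [MeasurableSingletonClass (NodePair V)]

theorem integral_pathFraction (v : V) :
    ∫ d, pathFraction T c v d ∂(PMF.uniformOfFintype (NodePair V)).toMeasure =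
      T.betweenness c v := by
  simp only [PMF.integral_eq_sum, PMF.uniformOfFintype_apply, ENNReal.toReal_inv,
    ENNReal.toReal_natCast, smul_eq_mul]
  rw [← Finset.mul_sum, card_nodePair, TemporalNetwork.betweenness, one_div]
  rfl

theorem toMeasure_onbra (η : ℝ) :
    (onbra T c η ℓ).toMeasure =
      (Measure.pi fun _ : Fin ℓ => (PMF.uniformOfFintype (NodePair V)).toMeasure).map fun ω =>
        (accuracy η fun v i => pathFraction T c v (ω i),
          average fun v i => pathFraction T c v (ω i)) := by
  set ν := Measure.pi fun _ : Fin ℓ => (PMF.uniformOfFintype (NodePair V)).toMeasure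
  have hestimates : estimates T c ℓ = ν.toPMF.map fun ω v i => pathFraction T c v (ω i) := by
    rw [estimates, foldlM_bind_pure_eq_map_foldl (Measure.toPMF_toMeasure ν)
      (fun i d B => processSample T c i d B) (List.nodup_finRange ℓ)]
    congr with ω v i
    simp [foldl_processSample_apply T c ω (List.nodup_finRange ℓ)]
  have honbra : onbra T c η ℓ = (estimates T c ℓ).map fun B => (accuracy η B, average B) :=
    PMF.bind_pure_comp _ _
  rw [honbra, hestimates, PMF.map_comp, ← PMF.toMeasure_map _ _ .of_discrete,
    Measure.toPMF_toMeasure]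
  rfl

theorem one_sub_lt_measureReal_pi_iSup_abs_sub_le_accuracy {η : ℝ} (hη₀ : 0 < η)
    (hη₁ : η < 1) (hℓ : 2 ≤ ℓ) :
    1 - η < (Measure.pi fun _ : Fin ℓ => (PMF.uniformOfFintype (NodePair V)).toMeasure).real
      {ω | ⨆ v, |average (fun v i => pathFraction T c v (ω i)) v - T.betweenness c v| ≤
        accuracy η fun v i => pathFraction T c v (ω i)} := by
  set p := (PMF.uniformOfFintype (NodePair V)).toMeasure
  have heval (i : Fin ℓ) : MeasurePreserving (Function.eval i) (Measure.pi fun _ => p) p :=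
    measurePreserving_eval _ i
  refine one_sub_lt_measureReal_iSup_abs_average_sub_le_accuracy
    (σ := fun v => Var[pathFraction T c v; p]) hℓ hη₀ hη₁
    (fun v => iIndepFun_pi fun _ => Measurable.of_discrete.aemeasurable)
    (fun v i => Measurable.of_discrete.aemeasurable)
    (fun v i => .of_forall fun ω => pathFraction_mem_Icc T c v (ω i)) (fun v i => ?_)
    (fun v i => (heval i).variance_fun_comp Measurable.of_discrete.aemeasurable)
  rw [← integral_pathFraction T c v]
  exact integral_comp_eval (μ := fun _ => p) .of_discrete

end ONBRA

end Algorithm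

theorem corollary1 {V : Type*} [Fintype V] [DecidableEq V] [Nontrivial V]
    (T : TemporalNetwork V) (c : PathCriterion) (η : ℝ) (hη₀ : 0 < η) (hη₁ : η < 1)
    (ℓ : ℕ) (hℓ : 2 ≤ ℓ) :
    1 - η < (ONBRA.onbra T c η ℓ).toMeasure.real
      {out : ℝ × (V → ℝ) | (⨆ v : V, |out.2 v - T.betweenness c v|) ≤ out.1} := by
  let _ : MeasurableSpace (NodePair V) := ⊤
  have hmeas : MeasurableSet
      {out : ℝ × (V → ℝ) | (⨆ v : V, |out.2 v - T.betweenness c v|) ≤ out.1} :=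
    measurableSet_le (.iSup fun v => by fun_prop) measurable_fst
  rw [ONBRA.toMeasure_onbra, MeasureTheory.map_measureReal_apply .of_discrete hmeas]
  exact ONBRA.one_sub_lt_measureReal_pi_iSup_abs_sub_le_accuracy T c hη₀ hη₁ hℓ
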